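/- Let $n\ge 1$. Let $\mathcal C_n(\mathbb R)$ be the real associative algebra generated by $i_1,\dots,i_{n-1}$ subject to $i_h^2=-1$ and $i_hi_k=-i_ki_h$ for $h\ne k$, so that $\mathcal C_n(\mathbb R)\subset \mathcal C_{n+1}(\mathbb R)$. It has as a basis the products $I=i_{j_1}\cdots i_{j_r}$ with $j_1<\dots<j_r$. For $a=\sum_I a_I I$ put $|a|^2=\sum_I a_I^2$ and let $\mathrm{Re}(a)$ be the coefficient of $a$ at $1$. Let $a\mapsto a'$ be the automorphism with $i_h\mapsto -i_h$, let $a\mapsto a^*$ be the anti-automorphism that reverses products of generators, and put $\overline a=(a')^*$. Let $\mathbb V^n(\mathbb R)$ be the space of vectors $a_0+a_1i_1+\dots+a_{n-1}i_{n-1}$, and let $\Gamma_n(\mathbb R)$ be the group of all products of invertible vectors. Let $\mathrm{SL}_+(\Gamma_n(\mathbb R))$ be the group of matrices $\begin{pmatrix}\alpha&\beta\\ \gamma&\delta\end{pmatrix}$ with entries in $\Gamma_n(\mathbb R)\cup\{0\}$ such that $\alpha\beta^*,\gamma\delta^*,\gamma^*\alpha,\delta^*\beta\in\mathbb V^n(\mathbb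 R)$ and $\alpha\delta^*-\beta\gamma^*=1$, and let $\mathrm{SU}_+(\Gamma_n(\mathbb R))$ be the set of its elements of the form $\begin{pmatrix}\alpha&\gamma\\ -\gamma'&\alpha'\end{pmatrix}$. Let $\mathbb H^{n+1}=\{z_0+z_1i_1+\dots+z_ni_n\in\mathbb V^{n+1}(\mathbb R) : z_n>0\}$ with its hyperbolic distance $\rho$, given by $\cosh\rho(z,w)=1+\frac{|z-w|^2}{2z_nw_n}$. The group $\mathrm{SL}_+(\Gamma_n(\mathbb R))$ acts on it by $\begin{pmatrix}\alpha&\beta\\ \gamma&\delta\end{pmatrix}z=(\alpha z+\beta)(\gamma z+\delta)^{-1}$, computed in $\mathcal C_{n+1}(\mathbb R)$. Put $\Sigma_{M}(p)=\{z\in\mathbb H^{n+1} : \rho(p,z)=\rho(z,M(p))\}$. Theorem. Let $M=\begin{pmatrix}\alpha&\beta\\ \gamma&\delta\end{pmatrix}\in \mathrm{SL}_+(\Gamma_n(\mathbb R))\setminus \mathrm{SU}_+(\Gamma_n(\mathbb R))$ and put $v=\beta^*\alpha'+\delta^*\gamma'$. Then $v\in\mathbb V^n(\mathbb R)$, and the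 following hold. 1. $\Sigma_{M^{-1}}(i_n)$ is a Euclidean half-sphere (the part in $\mathbb H^{n+1}$ of a Euclidean sphere of positive radius centred at a point of $\mathbb V^n(\mathbb R)$) if and only if $|\alpha|^2+|\gamma|^2\neq 1$. In this case its centre is $P=\frac{-(\beta^*\alpha'+\delta^*\gamma')}{|\alpha|^2+|\gamma|^2-1}\in\mathbb V^n(\mathbb R)$ and its radius $R>0$ is given by $R^2=\frac{1+|P|^2}{|\alpha|^2+|\gamma|^2}$. 2. $\Sigma_{M^{-1}}(i_n)$ is a hyperplane (the nonempty intersection of $\mathbb H^{n+1}$ with a Euclidean hyperplane of $\mathbb V^{n+1}(\mathbb R)$) if and only if $|\alpha|^2+|\gamma|^2=1$. In this case $\Sigma_{M^{-1}}(i_n)=\{z\in\mathbb H^{n+1} : \mathrm{Re}(\overline v z)+\frac{|v|^2}{2}=0\}$. -/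

import Mathlib

noncomputable section

namespace VahlenBisector

/-- The negative definite quadratic form `x ↦ -(x₁² + ⋯ + x_m²)` on `ℝ^m`. -/
def negForm (m : ℕ) : QuadraticForm ℝ (Fin m → ℝ) :=
  QuadraticMap.weightedSumSquares ℝ (fun _ : Fin m => (-1 : ℝ))

/-- The real Clifford algebra with `m` generators `i₁, …, i_m`, subject to `i_h² = -1` and
`i_h i_k = - i_k i_h` for `h ≠ k`. With `n = m + 1` this is the algebra usually written `𝒞_n(ℝ)`,
which has `n - 1` generators. -/
abbrev Cliff (m : ℕ) : Type := CliffordAlgebra (negForm m)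

/-- The generators. `gen m k` is `i_{k+1}`, as `Fin m` starts at `0`. -/
def gen (m : ℕ) (k : Fin m) : Cliff m := CliffordAlgebra.ι (negForm m) (Pi.single k 1)

/-- The product of the generators `i_k`, `k ∈ I`, taken in increasing order of the indices. -/
def monomial (m : ℕ) (I : Finset (Fin m)) : Cliff m := ((I.sort (· ≤ ·)).map (gen m)).prod

theorem gen_sq (m : ℕ) (k : Fin m) : gen m k * gen m k = -1 := by
  unfold gen
  have h : negForm m (Pi.single k 1) = -1 := by simp [negForm, Pi.single_apply]
  rw [CliffordAlgebra.ι_sq_scalar, h, map_neg, map_one]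

theorem polar_single (m : ℕ) (h k : Fin m) (hk : h ≠ k) :
    QuadraticMap.polar (negForm m) (Pi.single h 1) (Pi.single k 1) = 0 := by
  simp only [QuadraticMap.polar, negForm, QuadraticMap.weightedSumSquares_apply, Pi.add_apply,
    smul_eq_mul, ← Finset.sum_sub_distrib]
  refine Finset.sum_eq_zero fun i _ => ?_
  by_cases h1 : i = h
  · subst h1
    simp [Pi.single_eq_of_ne hk]
  · simp [Pi.single_eq_of_ne h1]

theorem gen_anticomm (m : ℕ) (h k : Fin m) (hk : h ≠ k) :
    gen m h * gen m k = -(gen m k * gen m h) := by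
  unfold gen
  rw [eq_neg_iff_add_eq_zero, CliffordAlgebra.ι_mul_ι_add_swap, polar_single m h k hk, map_zero]

/-- The monomials, transported to the exterior algebra, are the standard basis vectors there. -/
theorem equivExterior_monomial (m : ℕ) (I : Finset (Fin m)) :
    CliffordAlgebra.equivExterior (negForm m) (monomial m I)
      = (Pi.basisFun ℝ (Fin m)).ExteriorAlgebra I := by
  have key : ∀ l : List (Fin m), l.Nodup →
      CliffordAlgebra.equivExterior (negForm m) ((l.map (gen m)).prod)
        = (l.map fun k => ExteriorAlgebra.ι ℝ (Pi.basisFun ℝ (Fin m) k)).prod := by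
    have contr : ∀ (d : Module.Dual ℝ (Fin m → ℝ)) (l : List (Fin m)),
        (∀ k ∈ l, d (Pi.single k 1) = 0) →
        CliffordAlgebra.contractLeft (Q := (0 : QuadraticForm ℝ (Fin m → ℝ))) d
          ((l.map fun k => ExteriorAlgebra.ι ℝ (Pi.basisFun ℝ (Fin m) k)).prod) = 0 := by
      intro d l
      induction l with
      | nil =>
        intro _
        simp only [List.map_nil, List.prod_nil]
        exact CliffordAlgebra.contractLeft_one (Q := 0) d
      | cons a l ih =>
        intro h
        simp only [List.map_cons, List.prod_cons]
        refine (CliffordAlgebra.contractLeft_ι_mul d _ _).trans ?_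
        rw [ih fun k hk => h k (List.mem_cons_of_mem _ hk)]
        simp [h a List.mem_cons_self]
    intro l
    induction l with
    | nil =>
      intro _
      simp only [List.map_nil, List.prod_nil]
      exact CliffordAlgebra.changeForm_one CliffordAlgebra.changeForm.associated_neg_proof
    | cons a l ih =>
      intro h
      rw [List.nodup_cons] at h
      simp only [List.map_cons, List.prod_cons]
      refine (CliffordAlgebra.changeForm_ι_mul
        CliffordAlgebra.changeForm.associated_neg_proof _ _).trans ?_
      have ih' := ih h.2
      simp only [CliffordAlgebra.equivExterior, CliffordAlgebra.changeFormEquiv_apply] at ih'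
      rw [ih', contr _ l, sub_zero, Pi.basisFun_apply]
      intro k hk
      have hak : a ≠ k := fun e => h.1 (e ▸ hk)
      have h0 := polar_single m a k hak
      simp only [QuadraticMap.polar] at h0
      simp [QuadraticMap.associated_apply, h0]
  rw [monomial, key _ (I.sort_nodup _), ExteriorAlgebra.basis_apply_ofCard _ rfl]
  refine Eq.trans ?_ (ExteriorAlgebra.ιMulti_apply _).symm
  congr 1
  rw [← Finset.listMap_orderEmbOfFin_finRange I rfl, List.map_map, List.ofFn_eq_map]
  rfl

/-- The basis of the Clifford algebra that consists of the monomials `i_{j₁} ⋯ i_{j_r}` with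
`j₁ < ⋯ < j_r`; see `basis_apply`. -/
def basis (m : ℕ) : Module.Basis (Finset (Fin m)) ℝ (Cliff m) :=
  (Pi.basisFun ℝ (Fin m)).ExteriorAlgebra.map
    (CliffordAlgebra.equivExterior (negForm m)).symm

theorem basis_apply (m : ℕ) (I : Finset (Fin m)) : basis m I = monomial m I := by
  rw [basis, Module.Basis.map_apply, LinearEquiv.symm_apply_eq, equivExterior_monomial]

/-- The coefficient of `a` at the monomial indexed by `I`. -/
def coeff {m : ℕ} (I : Finset (Fin m)) (a : Cliff m) : ℝ := (basis m).repr a I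

/-- The real part of `a`: its coefficient at the monomial `1`. -/
def re {m : ℕ} (a : Cliff m) : ℝ := coeff ∅ a

/-- `|a|²`, the sum of the squares of the coefficients of `a` at the monomials. -/
def normSq {m : ℕ} (a : Cliff m) : ℝ := ∑ I : Finset (Fin m), coeff I a ^ 2

/-- The main conjugation `a ↦ a'`, the automorphism that replaces each `i_h` by `-i_h`. -/
def prim {m : ℕ} (a : Cliff m) : Cliff m := CliffordAlgebra.involute a

/-- The reversion `a ↦ a*`, the anti-automorphism that reverses products of generators. -/
def rev {m : ℕ} (a : Cliff m) : Cliff m := CliffordAlgebra.reverse a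

/-- The conjugation `a ↦ ā = (a')*`. -/
def conj {m : ℕ} (a : Cliff m) : Cliff m := rev (prim a)

/-- The Clifford vectors `a₀ + a₁ i₁ + ⋯ + a_m i_m`; with `n = m + 1` this is the space
`𝕍^n(ℝ)`, of dimension `n`. -/
def vectors (m : ℕ) : Submodule ℝ (Cliff m) :=
  Submodule.span ℝ (insert 1 (Set.range (gen m)))

/-- The Clifford group `Γ_n(ℝ)` (`n = m + 1`): all products of invertible vectors. -/
def cliffordGroup (m : ℕ) : Submonoid (Cliff m) :=
  Submonoid.closure {a | a ∈ vectors m ∧ IsUnit a}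

/-- `GL(Γ_n(ℝ))` with `n = m + 1`. -/
structure IsGL {m : ℕ} (M : Matrix (Fin 2) (Fin 2) (Cliff m)) : Prop where
  entries : ∀ i j, M i j ∈ cliffordGroup m ∨ M i j = 0
  det_ne_zero : M 0 0 * rev (M 1 1) - M 0 1 * rev (M 1 0) ≠ 0
  vec_ab : M 0 0 * rev (M 0 1) ∈ vectors m
  vec_cd : M 1 0 * rev (M 1 1) ∈ vectors m
  vec_ca : rev (M 1 0) * M 0 0 ∈ vectors m
  vec_db : rev (M 1 1) * M 0 1 ∈ vectors m

/-- `SL₊(Γ_n(ℝ))` with `n = m + 1`. -/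
def SLplus (m : ℕ) : Set (Matrix (Fin 2) (Fin 2) (Cliff m)) :=
  {M | IsGL M ∧ M 0 0 * rev (M 1 1) - M 0 1 * rev (M 1 0) = 1}

/-- `SU₊(Γ_n(ℝ))` with `n = m + 1`: the elements of `SL₊(Γ_n(ℝ))` of the form
`(α, γ; -γ', α')`. -/
def SUplus (m : ℕ) : Set (Matrix (Fin 2) (Fin 2) (Cliff m)) :=
  SLplus m ∩ {M | ∃ α γ : Cliff m, (α ∈ cliffordGroup m ∨ α = 0) ∧
    (γ ∈ cliffordGroup m ∨ γ = 0) ∧ M = !![α, γ; -prim γ, prim α]}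

/-- The isometric inclusion `ℝ^m → ℝ^(m+1)`, `x ↦ (x, 0)`. -/
def inclIsometry (m : ℕ) : negForm m →qᵢ negForm (m + 1) where
  toFun x := Fin.snoc (α := fun _ => ℝ) x 0
  map_add' x y := by
    ext i
    refine Fin.lastCases ?_ (fun j => ?_) i <;> simp
  map_smul' c x := by
    ext i
    refine Fin.lastCases ?_ (fun j => ?_) i <;> simp
  map_app' x := by
    simp [negForm, Fin.sum_univ_castSucc]

/-- The inclusion of the Clifford algebra with generators `i₁, …, i_m` into the one with
generators `i₁, …, i_{m+1}`. -/
def incl {m : ℕ} : Cliff m →ₐ[ℝ] Cliff (m + 1) := CliffordAlgebra.map (inclIsometry m)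

theorem incl_gen (m : ℕ) (k : Fin m) : incl (gen m k) = gen (m + 1) k.castSucc := by
  unfold incl gen
  rw [CliffordAlgebra.map_apply_ι]
  congr 1
  funext i
  change Fin.snoc (α := fun _ => ℝ) (Pi.single k 1 : Fin m → ℝ) 0 i = _
  refine Fin.lastCases ?_ (fun j => ?_) i
  · simp
  · simp [Pi.single_apply]

/-- `i_n`, where `n = m + 1`: the last generator of `Cliff (m + 1)`. -/
def lastGen (m : ℕ) : Cliff (m + 1) := gen (m + 1) (Fin.last m)

/-- The last coordinate `z_n` of `z = z₀ + z₁ i₁ + ⋯ + z_n i_n`, where `n = m + 1`. -/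
def height {m : ℕ} (z : Cliff (m + 1)) : ℝ := coeff {Fin.last m} z

/-- The upper half-space `ℍ^{n+1} = {z₀ + z₁ i₁ + ⋯ + z_n i_n | z_n > 0}`, where `n = m + 1`. -/
def upperHalfSpace (m : ℕ) : Set (Cliff (m + 1)) := {z | z ∈ vectors (m + 1) ∧ 0 < height z}

/-- The hyperbolic distance of the upper half-space:
`cosh ρ(z, w) = 1 + |z - w|² / (2 z_n w_n)`. -/
def hypDist {m : ℕ} (z w : Cliff (m + 1)) : ℝ :=
  Real.arcosh (1 + normSq (z - w) / (2 * height z * height w))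

/-- The Möbius action `M z = (α z + β) (γ z + δ)⁻¹`, computed in `Cliff (m + 1)`. -/
def mobius {m : ℕ} (M : Matrix (Fin 2) (Fin 2) (Cliff m)) (z : Cliff (m + 1)) : Cliff (m + 1) :=
  (incl (M 0 0) * z + incl (M 0 1)) * Ring.inverse (incl (M 1 0) * z + incl (M 1 1))

/-- The bisector `Σ_M(p) = {z ∈ ℍ^{n+1} | ρ(p, z) = ρ(z, M p)}`. -/
def bisector {m : ℕ} (M : Matrix (Fin 2) (Fin 2) (Cliff m)) (p : Cliff (m + 1)) :
    Set (Cliff (m + 1)) :=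
  {z ∈ upperHalfSpace m | hypDist p z = hypDist z (mobius M p)}

/-- The part in `ℍ^{n+1}` of the Euclidean sphere of radius `R` around the point `c` of the
boundary `𝕍^n(ℝ)`. -/
def halfSphere {m : ℕ} (c : Cliff m) (R : ℝ) : Set (Cliff (m + 1)) :=
  {z ∈ upperHalfSpace m | normSq (z - incl c) = R ^ 2}

/-- Euclidean half-spheres of `ℍ^{n+1}`, centred on the boundary. -/
def IsHalfSphere {m : ℕ} (S : Set (Cliff (m + 1))) : Prop :=
  ∃ c ∈ vectors m, ∃ R : ℝ, 0 < R ∧ S = halfSphere c R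

/-- Nonempty intersections of `ℍ^{n+1}` with a Euclidean hyperplane `⟨u, z⟩ = Re(ū z) = t`
of `𝕍^{n+1}(ℝ)`. -/
def IsHyperplane {m : ℕ} (S : Set (Cliff (m + 1))) : Prop :=
  S.Nonempty ∧ ∃ u ∈ vectors (m + 1), u ≠ 0 ∧ ∃ t : ℝ,
    S = {z ∈ upperHalfSpace m | re (conj u * z) = t}

end VahlenBisector

end

noncomputable section

namespace VahlenBisector

open scoped symmDiff

variable {m : ℕ}

/-! ### Inner product on the Clifford algebra -/

/-! Put `s = |α|² + |γ|²`. The inverse of `M` has rows `(δ*, -β*)` and `(-γ*, α*)`, and `(-γ* i_n +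
α*)(γ i_n + α') = s`. Hence `M⁻¹(i_n) = (i_n - v) / s` (`mobius_inverse_lastGen`). For `z = x + t
i_n`, equality of the two values of `cosh ρ` becomes, after clearing denominators, `s (s - 1) (|x|²
+ t²) + 2 s ⟨x, v⟩ + |v|² + 1 - s = 0` (`mem_bisector_iff`). The terms linear in `t` cancel, so a
sphere is centred on the boundary and a hyperplane is vertical.

If `s ≠ 1`, completing the square gives the centre `P` and the radius. If `s = 1`, the equation is
`2 ⟨x, v⟩ + |v|² = 0`, a hyperplane as soon as `v ≠ 0`. The case `s = 1`, `v = 0` means that `M`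
fixes `i_n`, which forces `M` into `SU₊` (`mem_SUplus`). The two "only if" directions follow since
no half-sphere is a hyperplane section (`not_isHyperplane_halfSphere`).

The algebra behind this: left multiplication by `ā` is adjoint to left multiplication by `a`
(`ip_mul_left`), which identifies the sum of squared coefficients with `ā a` on the Clifford group.
Moreover `x ↦ ā x a'` preserves vectors, whence `v` is a vector (`rev_mul_prim_mem`). -/

instance finite_cliff (m : ℕ) : Module.Finite ℝ (Cliff m) := Module.Finite.of_basis (basis m)

instance noetherian_cliff (m : ℕ) : IsNoetherianRing (Cliff m) := IsNoetherianRing.of_finite ℝ _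

/-- The inner product for which the monomials are an orthonormal basis. -/
def ip (m : ℕ) : Cliff m →ₗ[ℝ] Cliff m →ₗ[ℝ] ℝ := (basis m).toDual

theorem ip_monomial (I J : Finset (Fin m)) :
    ip m (monomial m I) (monomial m J) = if I = J then 1 else 0 := by
  rw [← basis_apply, ← basis_apply, ip, Module.Basis.toDual_apply]

theorem ip_monomial_right (a : Cliff m) (I : Finset (Fin m)) :
    ip m a (monomial m I) = coeff I a := by
  rw [← basis_apply, ip, Module.Basis.toDual_eq_repr, coeff]

theorem ip_comm (a b : Cliff m) : ip m a b = ip m b a := by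
  have h : ip m = (ip m).flip := by
    refine (basis m).ext fun I => (basis m).ext fun J => ?_
    simp only [basis_apply, LinearMap.flip_apply, ip_monomial, eq_comm]
  conv_lhs => rw [h]
  rfl

theorem ip_eq_sum (a b : Cliff m) : ip m a b = ∑ I, coeff I a * coeff I b := by
  conv_lhs => rw [← (basis m).sum_repr b]
  rw [map_sum]
  refine Finset.sum_congr rfl fun I _ => ?_
  rw [map_smul, basis_apply, ip_monomial_right, smul_eq_mul, mul_comm]
  rfl

theorem ip_self (a : Cliff m) : ip m a a = normSq a := by
  rw [ip_eq_sum, normSq]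
  exact Finset.sum_congr rfl fun I _ => (sq _).symm

theorem monomial_empty : monomial m ∅ = 1 := by simp [monomial]

theorem monomial_singleton (k : Fin m) : monomial m {k} = gen m k := by simp [monomial]

theorem re_eq_ip (a : Cliff m) : re a = ip m 1 a := by
  rw [ip_comm, ← monomial_empty, ip_monomial_right, re]

theorem prod_gen_perm {l₁ l₂ : List (Fin m)} (h : l₁.Perm l₂) :
    (l₁.map (gen m)).prod = (l₂.map (gen m)).prod ∨
      (l₁.map (gen m)).prod = -(l₂.map (gen m)).prod := by
  induction h with
  | nil => exact Or.inl rfl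
  | cons x _ ih =>
    rcases ih with ih | ih <;> simp [ih]
  | swap x y l =>
    rcases eq_or_ne x y with rfl | hxy
    · exact Or.inl rfl
    · right
      simp only [List.map_cons, List.prod_cons, ← mul_assoc]
      rw [gen_anticomm m y x hxy.symm, neg_mul]
  | trans _ _ ih₁ ih₂ =>
    rcases ih₁ with ih₁ | ih₁ <;> rcases ih₂ with ih₂ | ih₂ <;> simp [ih₁, ih₂]

theorem gen_mul_monomial_of_notMem {k : Fin m} {I : Finset (Fin m)} (hk : k ∉ I) :
    gen m k * monomial m I = monomial m (insert k I) ∨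
      gen m k * monomial m I = -monomial m (insert k I) := by
  have h : (k :: I.sort (· ≤ ·)).Perm ((insert k I).sort (· ≤ ·)) := by
    refine List.Perm.trans ?_ (Finset.sort_perm_toList _ _).symm
    exact ((Finset.sort_perm_toList _ _).cons k).trans (Finset.toList_insert hk).symm
  simpa [monomial] using prod_gen_perm h

theorem gen_mul_gen_mul (k : Fin m) (a : Cliff m) : gen m k * (gen m k * a) = -a := by
  rw [← mul_assoc, gen_sq, neg_one_mul]

theorem gen_mul_monomial (k : Fin m) (I : Finset (Fin m)) :
    gen m k * monomial m I = monomial m (I ∆ {k}) ∨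
      gen m k * monomial m I = -monomial m (I ∆ {k}) := by
  by_cases hk : k ∈ I
  · have hI : I ∆ {k} = I.erase k := by
      ext j; simp only [Finset.mem_symmDiff, Finset.mem_singleton, Finset.mem_erase]; grind
    rw [hI]
    rcases gen_mul_monomial_of_notMem (Finset.notMem_erase k I) with h | h <;>
      rw [Finset.insert_erase hk] at h
    · right; rw [← h, gen_mul_gen_mul]
    · left; rw [eq_neg_iff_add_eq_zero, add_comm, ← eq_neg_iff_add_eq_zero] at h
      rw [h, mul_neg, gen_mul_gen_mul, neg_neg]
  · have hI : I ∆ {k} = insert k I := by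
      ext j; simp only [Finset.mem_symmDiff, Finset.mem_singleton, Finset.mem_insert]; grind
    rw [hI]
    exact gen_mul_monomial_of_notMem hk

/-- In the orthonormal basis of monomials, left multiplication by a generator is a signed
permutation, hence orthogonal. Its square is `-1`, so its adjoint is its negative. -/
theorem ip_gen_mul (k : Fin m) (a b : Cliff m) :
    ip m (gen m k * a) b = -ip m a (gen m k * b) := by
  have key : (ip m).comp (LinearMap.mulLeft ℝ (gen m k))
      = -(ip m).compl₂ (LinearMap.mulLeft ℝ (gen m k)) := by
    refine (basis m).ext fun I => (basis m).ext fun J => ?_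
    simp only [basis_apply, LinearMap.comp_apply, LinearMap.mulLeft_apply, LinearMap.neg_apply,
      LinearMap.compl₂_apply]
    by_cases hJ : J = I ∆ {k}
    · subst hJ
      rcases gen_mul_monomial k I with h | h
      · have h' := gen_mul_gen_mul k (monomial m I)
        rw [h] at h'
        rw [h, h', map_neg]
        simp [ip_monomial]
      · have h' := gen_mul_gen_mul k (monomial m I)
        rw [h, mul_neg, neg_inj] at h'
        rw [h, h']
        simp [ip_monomial]
    · have hI : I ≠ J ∆ {k} := by
        rintro rfl
        exact hJ (by rw [symmDiff_assoc, symmDiff_self, symmDiff_bot])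
      rcases gen_mul_monomial k I with h | h <;> rcases gen_mul_monomial k J with h' | h' <;>
        simp [h, h', ip_monomial, hI, Ne.symm hJ]
  exact LinearMap.congr_fun (LinearMap.congr_fun key a) b

theorem iota_eq_sum (w : Fin m → ℝ) :
    CliffordAlgebra.ι (negForm m) w = ∑ k, w k • gen m k := by
  conv_lhs => rw [pi_eq_sum_univ' w]
  simp only [map_sum, map_smul, gen]

theorem conj_mul (a b : Cliff m) : conj (a * b) = conj b * conj a := by
  simp [conj, prim, rev]

theorem conj_iota (w : Fin m → ℝ) :
    conj (CliffordAlgebra.ι (negForm m) w) = -CliffordAlgebra.ι (negForm m) w := by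
  simp [conj, prim, rev]

theorem conj_algebraMap (r : ℝ) : conj (algebraMap ℝ (Cliff m) r) = algebraMap ℝ (Cliff m) r := by
  simp [conj, prim, rev]

theorem conj_add (a b : Cliff m) : conj (a + b) = conj a + conj b := by
  simp [conj, prim, rev]

/-- Taking adjoints and conjugation both reverse products, so scalars and generators suffice; for
generators this is `ip_gen_mul`. -/
theorem ip_mul_left (c a b : Cliff m) : ip m (c * a) b = ip m a (conj c * b) := by
  induction c using CliffordAlgebra.induction generalizing a b with
  | algebraMap r =>
    simp [conj_algebraMap, ← Algebra.smul_def]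
  | ι w =>
    rw [conj_iota, iota_eq_sum]
    simp [Finset.sum_mul, ip_gen_mul]
  | mul x y hx hy => rw [mul_assoc, hx, hy, conj_mul, mul_assoc]
  | add x y hx hy => simp [conj_add, add_mul, hx, hy]

theorem re_conj_mul (a b : Cliff m) : re (conj a * b) = ip m a b := by
  rw [re_eq_ip, ← ip_mul_left, mul_one]

theorem normSq_eq_of_conj_mul {a : Cliff m} {r : ℝ}
    (h : conj a * a = algebraMap ℝ (Cliff m) r) : normSq a = r := by
  rw [← ip_self, ← re_conj_mul, h, Algebra.algebraMap_eq_smul_one, re_eq_ip, map_smul,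
    ← monomial_empty, ip_monomial]
  simp

/-! ### Clifford vectors -/

/-- The Clifford vector with real part `r` and coordinates `w` at the generators. -/
def vec (r : ℝ) (w : Fin m → ℝ) : Cliff m :=
  algebraMap ℝ (Cliff m) r + CliffordAlgebra.ι (negForm m) w

theorem smul_vec (c r : ℝ) (w : Fin m → ℝ) : c • vec r w = vec (c * r) (c • w) := by
  rw [vec, vec, smul_add, map_smul, map_mul, Algebra.smul_def c (algebraMap _ _ r)]

theorem mem_vectors {a : Cliff m} : a ∈ vectors m ↔ ∃ r w, a = vec r w := by
  constructor
  · intro h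
    refine Submodule.span_induction ?_ ⟨0, 0, by simp [vec]⟩ ?_ ?_ h
    · rintro x (rfl | ⟨k, rfl⟩)
      · exact ⟨1, 0, by simp [vec]⟩
      · exact ⟨0, Pi.single k 1, by simp [vec, gen]⟩
    · rintro _ _ _ _ ⟨r, w, rfl⟩ ⟨r', w', rfl⟩
      exact ⟨r + r', w + w', by simp only [vec, map_add]; abel⟩
    · rintro c _ _ ⟨r, w, rfl⟩
      refine ⟨c * r, c • w, ?_⟩
      exact smul_vec c r w
  · rintro ⟨r, w, rfl⟩
    refine add_mem ?_ ?_
    · rw [Algebra.algebraMap_eq_smul_one]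
      exact Submodule.smul_mem _ _ (Submodule.subset_span (Set.mem_insert _ _))
    · rw [iota_eq_sum]
      exact sum_mem fun k _ => Submodule.smul_mem _ _
        (Submodule.subset_span (Set.mem_insert_of_mem _ ⟨k, rfl⟩))

theorem vec_mem (r : ℝ) (w : Fin m → ℝ) : vec r w ∈ vectors m := mem_vectors.2 ⟨r, w, rfl⟩

theorem rev_vec (r : ℝ) (w : Fin m → ℝ) : rev (vec r w) = vec r w := by simp [vec, rev]

theorem rev_of_mem {a : Cliff m} (h : a ∈ vectors m) : rev a = a := by
  obtain ⟨r, w, rfl⟩ := mem_vectors.1 h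
  exact rev_vec r w

theorem conj_vec (r : ℝ) (w : Fin m → ℝ) : conj (vec r w) = vec r (-w) := by
  rw [vec, conj_add, conj_algebraMap, conj_iota, vec, map_neg]

theorem conj_mem {a : Cliff m} (h : a ∈ vectors m) : conj a ∈ vectors m := by
  obtain ⟨r, w, rfl⟩ := mem_vectors.1 h
  rw [conj_vec]
  exact vec_mem _ _

theorem vec_mul_conj (r : ℝ) (w : Fin m → ℝ) :
    vec r w * conj (vec r w) = algebraMap ℝ (Cliff m) (r ^ 2 + ∑ k, w k ^ 2) := by
  have h := CliffordAlgebra.ι_sq_scalar (negForm m) w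
  have h2 : negForm m w = -∑ k, w k ^ 2 := by
    simp [negForm, QuadraticMap.weightedSumSquares_apply, sq]
  rw [h2] at h
  rw [conj_vec, vec, vec, map_neg, mul_add, add_mul, add_mul, mul_neg, mul_neg, h,
    Algebra.commutes r (CliffordAlgebra.ι (negForm m) w)]
  simp only [map_neg, map_add, map_mul, neg_neg, sq]
  abel

theorem conj_mul_vec (r : ℝ) (w : Fin m → ℝ) :
    conj (vec r w) * vec r w = algebraMap ℝ (Cliff m) (r ^ 2 + ∑ k, w k ^ 2) := by
  have h := vec_mul_conj r (-w)
  rw [conj_vec, neg_neg] at h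
  rw [conj_vec, h]
  simp

theorem normSq_vec (r : ℝ) (w : Fin m → ℝ) : normSq (vec r w) = r ^ 2 + ∑ k, w k ^ 2 :=
  normSq_eq_of_conj_mul (conj_mul_vec r w)

theorem vec_add (r r' : ℝ) (w w' : Fin m → ℝ) :
    vec r w + vec r' w' = vec (r + r') (w + w') := by
  simp only [vec, map_add]; abel

theorem ip_vec (r r' : ℝ) (w w' : Fin m → ℝ) :
    ip m (vec r w) (vec r' w') = r * r' + ∑ k, w k * w' k := by
  have h := ip_self (vec r w + vec r' w')
  rw [map_add (ip m), LinearMap.add_apply, map_add, map_add, ip_self, ip_self,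
    ip_comm (vec r' w') (vec r w), vec_add, normSq_vec, normSq_vec, normSq_vec] at h
  have h2 : ∑ k, (w + w') k ^ 2 = ∑ k, w k ^ 2 + 2 * ∑ k, w k * w' k + ∑ k, w' k ^ 2 := by
    rw [Finset.mul_sum, ← Finset.sum_add_distrib, ← Finset.sum_add_distrib]
    exact Finset.sum_congr rfl fun k _ => by simp only [Pi.add_apply]; ring
  rw [h2] at h
  linarith

theorem coeff_singleton_vec (k : Fin m) (r : ℝ) (w : Fin m → ℝ) :
    coeff {k} (vec r w) = w k := by
  have h : gen m k = vec 0 (Pi.single k 1) := by simp [vec, gen]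
  rw [← ip_monomial_right, monomial_singleton, h, ip_vec]
  simp [Pi.single_apply]

theorem normSq_nonneg (a : Cliff m) : 0 ≤ normSq a := Finset.sum_nonneg fun _ _ => sq_nonneg _

theorem normSq_eq_zero {a : Cliff m} : normSq a = 0 ↔ a = 0 := by
  constructor
  · intro h
    rw [normSq, Finset.sum_eq_zero_iff_of_nonneg fun _ _ => sq_nonneg _] at h
    refine (basis m).ext_elem fun I => ?_
    simpa [coeff] using h I (Finset.mem_univ I)
  · rintro rfl
    simp [normSq, coeff]

/-! ### The Clifford group -/

/-- Polarising `y ȳ ∈ ℝ` shows that `a x + x̄ ā` is a scalar `c`. Multiplying by `a` on the right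
gives `a x a = c a - |a|² x̄`, a combination of vectors. -/
theorem mul_vec_mul_mem {a x : Cliff m} (ha : a ∈ vectors m) (hx : x ∈ vectors m) :
    a * x * a ∈ vectors m := by
  have hs : ∃ c : ℝ, a * x + conj x * conj a = algebraMap ℝ (Cliff m) c := by
    obtain ⟨r, w, rfl⟩ := mem_vectors.1 ha
    obtain ⟨r', w', rfl⟩ := mem_vectors.1 hx
    -- This is the norm of `a + x̄`; its cross terms are the required sum.
    have h := vec_mul_conj (r + r') (w - w')
    have e : vec (r + r') (w - w') = vec r w + conj (vec r' w') := by
      rw [conj_vec, vec_add, sub_eq_add_neg]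
    have e' : conj (conj (vec r' w')) = vec r' w' := by rw [conj_vec, conj_vec, neg_neg]
    rw [e, conj_add, e', mul_add, add_mul, add_mul, vec_mul_conj, conj_mul_vec] at h
    refine ⟨((r + r') ^ 2 + ∑ k, (w - w') k ^ 2) - (r ^ 2 + ∑ k, w k ^ 2)
      - (r' ^ 2 + ∑ k, w' k ^ 2), ?_⟩
    rw [map_sub, map_sub, ← h]
    abel
  obtain ⟨c, hc⟩ := hs
  obtain ⟨r, hr⟩ : ∃ r : ℝ, conj a * a = algebraMap ℝ (Cliff m) r := by
    obtain ⟨r, w, rfl⟩ := mem_vectors.1 ha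
    exact ⟨_, conj_mul_vec r w⟩
  have e : a * x * a = c • a - r • conj x := by
    rw [eq_sub_of_add_eq hc, sub_mul, mul_assoc, hr, ← Algebra.smul_def,
      ← Algebra.commutes, ← Algebra.smul_def]
  rw [e]
  exact sub_mem (Submodule.smul_mem _ _ ha) (Submodule.smul_mem _ _ (conj_mem hx))

theorem rev_mul (a b : Cliff m) : rev (a * b) = rev b * rev a := by simp [rev]

theorem prim_mul (a b : Cliff m) : prim (a * b) = prim a * prim b := by simp [prim]

theorem rev_rev (a : Cliff m) : rev (rev a) = a := by simp [rev]

theorem prim_prim (a : Cliff m) : prim (prim a) = a := by simp [prim]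

theorem rev_conj (a : Cliff m) : rev (conj a) = prim a := rev_rev _

theorem prim_rev (a : Cliff m) : prim (rev a) = conj a :=
  (CliffordAlgebra.reverse_involute a).symm

theorem prim_conj (a : Cliff m) : prim (conj a) = rev a := by
  rw [← prim_rev, prim_prim]

theorem isUnit_of_mem {a : Cliff m} (h : a ∈ cliffordGroup m) : IsUnit a := by
  induction h using Submonoid.closure_induction with
  | mem x hx => exact hx.2
  | one => exact isUnit_one
  | mul x y _ _ hx hy => exact hx.mul hy

theorem exists_conj_mul {a : Cliff m} (h : a ∈ cliffordGroup m) :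
    ∃ r : ℝ, conj a * a = algebraMap ℝ (Cliff m) r := by
  induction h using Submonoid.closure_induction with
  | mem x hx =>
    obtain ⟨r, w, rfl⟩ := mem_vectors.1 hx.1
    exact ⟨_, conj_mul_vec r w⟩
  | one => exact ⟨1, by simp [conj, prim, rev]⟩
  | mul x y _ _ hx hy =>
    obtain ⟨r, hr⟩ := hx
    obtain ⟨q, hq⟩ := hy
    refine ⟨r * q, ?_⟩
    rw [conj_mul, mul_assoc, ← mul_assoc (conj x), hr, ← mul_assoc,
      ← Algebra.commutes, mul_assoc, hq, map_mul]

/-- Reversion fixes vectors, so `a' = ā` for a vector `a`, and `mul_vec_mul_mem` applies. For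
products the maps compose. -/
theorem conj_mul_mul_prim_mem {a : Cliff m} (h : a ∈ cliffordGroup m) :
    ∀ x ∈ vectors m, conj a * x * prim a ∈ vectors m := by
  induction h using Submonoid.closure_induction with
  | mem a ha =>
    intro x hx
    rw [← rev_conj a, rev_of_mem (conj_mem ha.1)]
    exact mul_vec_mul_mem (conj_mem ha.1) hx
  | one => intro x hx; simpa [conj, prim, rev] using hx
  | mul a b _ _ ha hb =>
    intro x hx
    have := hb _ (ha x hx)
    rw [conj_mul, prim_mul]
    simpa only [mul_assoc] using this

theorem conj_mul_self {a : Cliff m} (h : a ∈ cliffordGroup m ∨ a = 0) :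
    conj a * a = algebraMap ℝ (Cliff m) (normSq a) := by
  rcases h with h | rfl
  · obtain ⟨r, hr⟩ := exists_conj_mul h
    rw [hr, normSq_eq_of_conj_mul hr]
  · rw [mul_zero, normSq_eq_zero.2 rfl, map_zero]

theorem rev_mul_prim {a : Cliff m} (h : a ∈ cliffordGroup m ∨ a = 0) :
    rev a * prim a = algebraMap ℝ (Cliff m) (normSq a) := by
  rw [← prim_conj, ← prim_mul, conj_mul_self h]
  simp [prim]

/-- For `a ≠ 0`, `ā (a b*) a' = |a|² b* a'` is a vector, and `|a|²` can be divided out. -/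
theorem rev_mul_prim_mem {a b : Cliff m} (h : a ∈ cliffordGroup m ∨ a = 0)
    (hab : a * rev b ∈ vectors m) : rev b * prim a ∈ vectors m := by
  rcases h with h | rfl
  · have h0 : normSq a ≠ 0 := fun h0 =>
      (isUnit_of_mem h).ne_zero (normSq_eq_zero.1 h0)
    have h1 := conj_mul_mul_prim_mem h _ hab
    rw [← mul_assoc, conj_mul_self (Or.inl h), mul_assoc, ← Algebra.smul_def] at h1
    have h2 := Submodule.smul_mem _ (normSq a)⁻¹ h1
    rwa [smul_smul, inv_mul_cancel₀ h0, one_smul] at h2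
  · simp [prim]

/-! ### The half-space -/

theorem incl_vec (r : ℝ) (w : Fin m → ℝ) :
    incl (vec r w) = vec r (Fin.snoc (α := fun _ => ℝ) w 0) := by
  rw [vec, map_add, AlgHom.commutes, incl, CliffordAlgebra.map_apply_ι]
  rfl

theorem incl_vec_add_smul (r : ℝ) (w : Fin m → ℝ) (t : ℝ) :
    incl (vec r w) + t • lastGen m = vec r (Fin.snoc (α := fun _ => ℝ) w t) := by
  have h : lastGen m = vec 0 (Pi.single (Fin.last m) 1) := by simp [vec, gen, lastGen]
  rw [incl_vec, h, smul_vec, vec_add, mul_zero, add_zero]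
  congr 1
  ext i
  refine Fin.lastCases ?_ (fun j => ?_) i <;> simp

theorem mem_vectors_succ {z : Cliff (m + 1)} :
    z ∈ vectors (m + 1) ↔ ∃ x ∈ vectors m, ∃ t : ℝ, z = incl x + t • lastGen m := by
  constructor
  · intro h
    obtain ⟨r, w, rfl⟩ := mem_vectors.1 h
    refine ⟨_, vec_mem r (Fin.init (α := fun _ => ℝ) w), w (Fin.last m), ?_⟩
    rw [incl_vec_add_smul, Fin.snoc_init_self]
  · rintro ⟨x, hx, t, rfl⟩
    obtain ⟨r, w, rfl⟩ := mem_vectors.1 hx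
    rw [incl_vec_add_smul]
    exact vec_mem _ _

theorem height_incl_add {x : Cliff m} (hx : x ∈ vectors m) (t : ℝ) :
    height (incl x + t • lastGen m) = t := by
  obtain ⟨r, w, rfl⟩ := mem_vectors.1 hx
  rw [incl_vec_add_smul, height, coeff_singleton_vec, Fin.snoc_last]

theorem ip_incl_add {x y : Cliff m} (hx : x ∈ vectors m) (hy : y ∈ vectors m) (t u : ℝ) :
    ip (m + 1) (incl x + t • lastGen m) (incl y + u • lastGen m) = ip m x y + t * u := by
  obtain ⟨r, w, rfl⟩ := mem_vectors.1 hx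
  obtain ⟨r', w', rfl⟩ := mem_vectors.1 hy
  rw [incl_vec_add_smul, incl_vec_add_smul, ip_vec, ip_vec, Fin.sum_univ_castSucc]
  simp only [Fin.snoc_castSucc, Fin.snoc_last]
  ring

theorem normSq_incl_add {x : Cliff m} (hx : x ∈ vectors m) (t : ℝ) :
    normSq (incl x + t • lastGen m) = normSq x + t ^ 2 := by
  rw [← ip_self, ip_incl_add hx hx, ip_self, sq]

theorem incl_add_mem_upperHalfSpace {x : Cliff m} (hx : x ∈ vectors m) {t : ℝ} :
    incl x + t • lastGen m ∈ upperHalfSpace m ↔ 0 < t := by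
  change _ ∧ _ ↔ _
  rw [height_incl_add hx]
  exact and_iff_right (mem_vectors_succ.2 ⟨x, hx, t, rfl⟩)

theorem mem_upperHalfSpace {z : Cliff (m + 1)} :
    z ∈ upperHalfSpace m ↔ ∃ x ∈ vectors m, ∃ t : ℝ, 0 < t ∧ z = incl x + t • lastGen m := by
  constructor
  · intro h
    obtain ⟨x, hx, t, rfl⟩ := mem_vectors_succ.1 h.1
    exact ⟨x, hx, t, (incl_add_mem_upperHalfSpace hx).1 h, rfl⟩
  · rintro ⟨x, hx, t, ht, rfl⟩
    exact (incl_add_mem_upperHalfSpace hx).2 ht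

theorem subset_ext {S T : Set (Cliff (m + 1))} (hS : S ⊆ upperHalfSpace m)
    (hT : T ⊆ upperHalfSpace m)
    (h : ∀ x ∈ vectors m, ∀ t : ℝ, 0 < t →
      (incl x + t • lastGen m ∈ S ↔ incl x + t • lastGen m ∈ T)) : S = T := by
  ext z
  constructor <;> intro hz
  · obtain ⟨x, hx, t, ht, rfl⟩ := mem_upperHalfSpace.1 (hS hz)
    exact (h x hx t ht).1 hz
  · obtain ⟨x, hx, t, ht, rfl⟩ := mem_upperHalfSpace.1 (hT hz)
    exact (h x hx t ht).2 hz

theorem normSq_sub (a b : Cliff m) : normSq (a - b) = normSq a - 2 * ip m a b + normSq b := by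
  rw [← ip_self, map_sub (ip m), LinearMap.sub_apply, map_sub, map_sub, ip_self, ip_self,
    ip_comm b a]
  ring

theorem normSq_smul (c : ℝ) (a : Cliff m) : normSq (c • a) = c ^ 2 * normSq a := by
  rw [← ip_self, map_smul (ip m), LinearMap.smul_apply, map_smul, ip_self, smul_eq_mul,
    smul_eq_mul]
  ring

theorem normSq_neg (a : Cliff m) : normSq (-a) = normSq a := by
  simp [normSq, coeff]

theorem mem_halfSphere {c x : Cliff m} (hc : c ∈ vectors m) (hx : x ∈ vectors m) {t : ℝ}
    (R : ℝ) : incl x + t • lastGen m ∈ halfSphere c R ↔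
      0 < t ∧ normSq x - 2 * ip m x c + normSq c + t ^ 2 = R ^ 2 := by
  change _ ∧ _ ↔ _
  rw [incl_add_mem_upperHalfSpace hx, add_sub_right_comm, ← map_sub,
    normSq_incl_add (sub_mem hx hc), normSq_sub]

/-- `arcosh` is injective on `[1, ∞)`, and the height `u` of the middle point occurs in both
denominators and cancels. -/
theorem hypDist_eq_iff {x y a : Cliff m} (hx : x ∈ vectors m) (hy : y ∈ vectors m)
    (ha : a ∈ vectors m) {t u b : ℝ} (ht : 0 < t) (hu : 0 < u) (hb : 0 < b) :
    hypDist (incl x + t • lastGen m) (incl y + u • lastGen m)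
        = hypDist (incl y + u • lastGen m) (incl a + b • lastGen m) ↔
      (normSq (x - y) + (t - u) ^ 2) * b = (normSq (y - a) + (u - b) ^ 2) * t := by
  have key : ∀ {x y : Cliff m}, x ∈ vectors m → y ∈ vectors m → ∀ t u : ℝ,
      normSq (incl x + t • lastGen m - (incl y + u • lastGen m))
        = normSq (x - y) + (t - u) ^ 2 := by
    intro x y hx hy t u
    rw [← normSq_incl_add (sub_mem hx hy), map_sub, sub_smul]
    congr 1
    abel
  rw [hypDist, hypDist, key hx hy, key hy ha, height_incl_add hx, height_incl_add hy,
    height_incl_add ha]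
  have p1 := normSq_nonneg (x - y)
  have p2 := normSq_nonneg (y - a)
  rw [Real.arcosh_injOn.eq_iff (Set.mem_Ici.2 (le_add_of_nonneg_right (by positivity)))
    (Set.mem_Ici.2 (le_add_of_nonneg_right (by positivity))), add_right_inj,
    div_eq_div_iff (by positivity) (by positivity)]
  constructor <;> intro h
  · refine mul_left_cancel₀ (mul_pos two_pos hu).ne' ?_
    linear_combination h
  · linear_combination 2 * u * h

/-! ### The Möbius action -/

/-- `i_n` anticommutes with every generator of the smaller algebra, so moving it past `a` changes
the sign of each generator in `a`. -/
theorem lastGen_mul_incl (a : Cliff m) : lastGen m * incl a = incl (prim a) * lastGen m := by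
  induction a using CliffordAlgebra.induction with
  | algebraMap r => simp [prim, Algebra.commutes]
  | ι w =>
    simp only [iota_eq_sum, prim, map_sum, map_smul, incl_gen, Finset.mul_sum, Finset.sum_mul]
    refine Finset.sum_congr rfl fun k _ => ?_
    have h : CliffordAlgebra.involute (gen m k) = -gen m k := by simp [gen]
    rw [h, map_neg, incl_gen, mul_smul_comm, smul_mul_assoc, neg_mul, lastGen,
      gen_anticomm _ _ _ (Fin.castSucc_lt_last k).ne']
  | mul a b ha hb =>
    rw [map_mul, ← mul_assoc, ha, mul_assoc, hb, prim_mul, map_mul, mul_assoc]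
  | add a b ha hb =>
    have h : prim (a + b) = prim a + prim b := map_add _ a b
    rw [map_add, mul_add, ha, hb, h, map_add, add_mul]

theorem affine_mul (a b c d : Cliff m) :
    (incl a * lastGen m + incl b) * (incl c * lastGen m + incl d)
      = incl (a * prim d + b * c) * lastGen m + incl (b * d - a * prim c) := by
  have h1 : incl a * lastGen m * (incl c * lastGen m) = -(incl a * incl (prim c)) := by
    rw [mul_assoc, ← mul_assoc (lastGen m), lastGen_mul_incl, mul_assoc (incl (prim c)), lastGen,
      gen_sq, mul_neg_one, mul_neg]
  have h2 : incl a * lastGen m * incl d = incl a * incl (prim d) * lastGen m := by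
    rw [mul_assoc, lastGen_mul_incl, mul_assoc]
  rw [add_mul, mul_add, mul_add, h1, h2]
  simp only [map_add, map_sub, map_mul, add_mul, mul_assoc]
  abel

/-- Dedekind-finiteness makes a one-sided inverse two-sided. It is used in `Cliff (m + 1)` and for
matrices over `Cliff m`. -/
theorem inverse_eq_of_mul_eq_one {A : Type*} [Ring A] [IsDedekindFiniteMonoid A] {a b : A}
    (h : a * b = 1) : Ring.inverse a = b :=
  Ring.inverse_unit (⟨a, b, h, mul_eq_one_symm h⟩ : Aˣ)

/-- The inverse of an element of `SL₊`. -/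
theorem SLplus_mul_inverse {α β γ δ : Cliff m} (h : !![α, β; γ, δ] ∈ SLplus m) :
    !![α, β; γ, δ] * !![rev δ, -rev β; -rev γ, rev α] = 1 := by
  have h1 : α * rev δ - β * rev γ = 1 := h.2
  have h2 : β * rev α = α * rev β := by
    have := rev_of_mem h.1.vec_ab
    rwa [rev_mul, rev_rev] at this
  have h3 : δ * rev γ = γ * rev δ := by
    have := rev_of_mem h.1.vec_cd
    rwa [rev_mul, rev_rev] at this
  have h4 : δ * rev α - γ * rev β = 1 := by
    have := congrArg rev h1
    simpa [rev] using this
  rw [Matrix.mul_fin_two, Matrix.one_fin_two]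
  congr! 4
  · rw [mul_neg, ← sub_eq_add_neg, h1]
  · rw [mul_neg, h2, neg_add_cancel]
  · rw [mul_neg, h3, add_neg_cancel]
  · rw [mul_neg, neg_add_eq_sub, h4]

/-- These identities are entries of `M⁻¹ M = 1`, whereas the definition of `SL₊` supplies those of
`M M⁻¹ = 1`. -/
theorem SLplus_inverse_mul {α β γ δ : Cliff m} (h : !![α, β; γ, δ] ∈ SLplus m) :
    rev δ * α - rev β * γ = 1 ∧ rev δ * β = rev β * δ ∧ rev α * γ = rev γ * α := by
  have h1 := mul_eq_one_symm (SLplus_mul_inverse h)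
  rw [Matrix.mul_fin_two, Matrix.one_fin_two] at h1
  have e00 := congrFun (congrFun h1 0) 0
  have e01 := congrFun (congrFun h1 0) 1
  have e10 := congrFun (congrFun h1 1) 0
  simp only [Matrix.of_apply, Matrix.cons_val', Matrix.cons_val_zero, Matrix.cons_val_one,
    Matrix.cons_val_fin_one, neg_mul] at e00 e01 e10
  exact ⟨by rw [sub_eq_add_neg, e00], add_neg_eq_zero.1 e01, (neg_add_eq_zero.1 e10).symm⟩

theorem SLplus_vector_mem {α β γ δ : Cliff m} (h : !![α, β; γ, δ] ∈ SLplus m) :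
    rev β * prim α + rev δ * prim γ ∈ vectors m :=
  add_mem (rev_mul_prim_mem (h.1.entries 0 0) h.1.vec_ab)
    (rev_mul_prim_mem (h.1.entries 1 0) h.1.vec_cd)

theorem SLplus_normSq_pos {α β γ δ : Cliff m} (h : !![α, β; γ, δ] ∈ SLplus m) :
    0 < normSq α + normSq γ := by
  refine lt_of_le_of_ne (add_nonneg (normSq_nonneg _) (normSq_nonneg _)) fun h0 => ?_
  have hα : α = 0 := normSq_eq_zero.1 (by linarith [normSq_nonneg α, normSq_nonneg γ])
  have hγ : γ = 0 := normSq_eq_zero.1 (by linarith [normSq_nonneg α, normSq_nonneg γ])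
  have h1 := (SLplus_inverse_mul h).1
  rw [hα, hγ, mul_zero, mul_zero, sub_zero] at h1
  exact zero_ne_one h1

theorem mobius_inverse_lastGen {α β γ δ : Cliff m} (h : !![α, β; γ, δ] ∈ SLplus m) :
    mobius (Ring.inverse !![α, β; γ, δ]) (lastGen m)
      = incl (-((normSq α + normSq γ)⁻¹ • (rev β * prim α + rev δ * prim γ)))
        + (normSq α + normSq γ)⁻¹ • lastGen m := by
  obtain ⟨h1, -, h3⟩ := SLplus_inverse_mul h
  have hα := rev_mul_prim (h.1.entries 0 0)
  have hγ := rev_mul_prim (h.1.entries 1 0)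
  simp only [Matrix.of_apply, Matrix.cons_val', Matrix.cons_val_zero, Matrix.cons_val_one,
    Matrix.cons_val_fin_one] at hα hγ
  have hs := (SLplus_normSq_pos h).ne'
  set s := normSq α + normSq γ with hsdef
  have hq : (incl (-rev γ) * lastGen m + incl (rev α)) *
      (incl γ * lastGen m + incl (prim α)) = algebraMap ℝ _ s := by
    -- The coefficient of `i_n` vanishes because `α* γ = γ* α`; the rest is `α* α' + γ* γ' = s`.
    have e1 : -rev γ * prim (prim α) + rev α * γ = 0 := by
      rw [prim_prim, h3, neg_mul, neg_add_cancel]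
    have e2 : rev α * prim α - -rev γ * prim γ = algebraMap ℝ (Cliff m) s := by
      rw [neg_mul, sub_neg_eq_add, hα, hγ, ← map_add]
    rw [affine_mul, e1, e2, map_zero, zero_mul, zero_add, AlgHom.commutes]
  have hinv : Ring.inverse (incl (-rev γ) * lastGen m + incl (rev α))
      = s⁻¹ • (incl γ * lastGen m + incl (prim α)) := by
    refine inverse_eq_of_mul_eq_one ?_
    rw [mul_smul_comm, hq, Algebra.algebraMap_eq_smul_one, smul_smul, inv_mul_cancel₀ hs,
      one_smul]
  have e1 : rev δ * prim (prim α) + -rev β * γ = 1 := by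
    rw [prim_prim, neg_mul, ← sub_eq_add_neg, h1]
  have e2 : -rev β * prim α - rev δ * prim γ = -(rev β * prim α + rev δ * prim γ) := by
    rw [neg_mul]; abel
  rw [inverse_eq_of_mul_eq_one (SLplus_mul_inverse h)]
  change (incl (rev δ) * lastGen m + incl (-rev β)) *
    Ring.inverse (incl (-rev γ) * lastGen m + incl (rev α)) = _
  rw [hinv, mul_smul_comm, affine_mul, e1, e2, map_one, one_mul, smul_add, ← smul_neg, map_smul]
  exact add_comm _ _

/-- The hypotheses say that `(ᾱ, γ̄) M = (1, 0)`. Hence `(ᾱ, γ̄)` is the first row `(δ*, -β*)` of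
`M⁻¹`, which gives `δ = α'` and `γ = -β'`. -/
theorem mem_SUplus {α β γ δ : Cliff m} (h : !![α, β; γ, δ] ∈ SLplus m)
    (hs : normSq α + normSq γ = 1) (hv : rev β * prim α + rev δ * prim γ = 0) :
    !![α, β; γ, δ] ∈ SUplus m := by
  have hα := conj_mul_self (h.1.entries 0 0)
  have hγ := conj_mul_self (h.1.entries 1 0)
  simp only [Matrix.of_apply, Matrix.cons_val', Matrix.cons_val_zero, Matrix.cons_val_one,
    Matrix.cons_val_fin_one] at hα hγ
  have e1 : conj α * α + conj γ * γ = 1 := by rw [hα, hγ, ← map_add, hs, map_one]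
  have e2 : conj α * β + conj γ * δ = 0 := by
    have := congrArg rev hv
    simpa [rev, conj, prim] using this
  -- The zero row only pads the row vector to a square matrix.
  have hrow : !![conj α, conj γ; 0, 0] * !![α, β; γ, δ] = !![1, 0; 0, 0] := by
    rw [Matrix.mul_fin_two, e1, e2]
    simp
  have h2 := congrArg (fun A => A * !![rev δ, -rev β; -rev γ, rev α]) hrow
  beta_reduce at h2
  rw [Matrix.mul_assoc, SLplus_mul_inverse h, Matrix.mul_one, Matrix.mul_fin_two] at h2
  have f0 := congrFun (congrFun h2 0) 0
  have f1 := congrFun (congrFun h2 0) 1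
  simp only [Matrix.of_apply, Matrix.cons_val', Matrix.cons_val_zero, Matrix.cons_val_one,
    Matrix.cons_val_fin_one, one_mul, zero_mul, add_zero] at f0 f1
  have hδ : prim α = δ := by rw [← rev_conj, f0, rev_rev]
  have hγ' : prim γ = -β := by
    rw [← rev_conj, f1]
    simp [rev]
  have hγ2 : γ = -prim β := by
    have := congrArg prim hγ'
    rw [prim_prim] at this
    rw [this]
    simp [prim]
  exact ⟨h, α, β, h.1.entries 0 0, h.1.entries 0 1, by rw [← hγ2, hδ]⟩

/-! ### Equation of the bisector; half-spheres are not hyperplanes -/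

/-- The equation of the bisector of `i_n` and `(i_n - v) / s`. -/
theorem mem_bisector_iff {M : Matrix (Fin 2) (Fin 2) (Cliff m)} {s : ℝ} (hs : 0 < s)
    {v : Cliff m} (hv : v ∈ vectors m)
    (hM : mobius M (lastGen m) = incl (-(s⁻¹ • v)) + s⁻¹ • lastGen m)
    {x : Cliff m} (hx : x ∈ vectors m) {t : ℝ} (ht : 0 < t) :
    incl x + t • lastGen m ∈ bisector M (lastGen m) ↔
      s * (s - 1) * (normSq x + t ^ 2) + 2 * s * ip m x v + normSq v + 1 - s = 0 := by
  have h0 : lastGen m = incl 0 + (1 : ℝ) • lastGen m := by rw [map_zero, zero_add, one_smul]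
  have ha : -(s⁻¹ • v) ∈ vectors m := neg_mem (Submodule.smul_mem _ _ hv)
  have key := hypDist_eq_iff (zero_mem _) hx ha one_pos ht (inv_pos.2 hs)
  rw [← h0, ← hM, zero_sub, normSq_neg, normSq_sub, normSq_neg, normSq_smul, map_neg,
    map_smul, smul_eq_mul, mul_one] at key
  change _ ∧ _ ↔ _
  rw [incl_add_mem_upperHalfSpace hx, key, and_iff_right ht]
  have e : s * (s - 1) * (normSq x + t ^ 2) + 2 * s * ip m x v + normSq v + 1 - s
      = s ^ 2 * ((normSq x - 2 * -(s⁻¹ * ip m x v) + s⁻¹ ^ 2 * normSq v + (t - s⁻¹) ^ 2)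
        - (normSq x + (1 - t) ^ 2) * s⁻¹) := by
    field_simp
    ring
  rw [e, mul_eq_zero, or_iff_right (pow_ne_zero 2 hs.ne'), sub_eq_zero, eq_comm]

theorem halfSphere_subset (c : Cliff m) (R : ℝ) : halfSphere c R ⊆ upperHalfSpace m :=
  fun _ h => h.1

/-- In the half-plane of points `c + r + t i_n`, with `r` real, the half-circle `r² + t² = R²` would
be cut out by one affine equation. Two of its points at equal height and its top force the
coefficient of `t` to vanish, so the point straight above the centre at height `2R` would also lie
on it. -/
theorem not_isHyperplane_halfSphere {c : Cliff m} (hc : c ∈ vectors m) {R : ℝ} (hR : 0 < R) :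
    ¬ IsHyperplane (halfSphere c R) := by
  rintro ⟨-, u, hu, -, t₀, h⟩
  obtain ⟨y, hy, b, rfl⟩ := mem_vectors_succ.1 hu
  have h1 : (1 : Cliff m) ∈ vectors m := Submodule.subset_span (Set.mem_insert _ _)
  have hn : normSq (1 : Cliff m) = 1 := normSq_eq_of_conj_mul (by simp [conj, prim, rev])
  have key : ∀ r t : ℝ, 0 < t →
      (r ^ 2 + t ^ 2 = R ^ 2 ↔ ip m y c + r * ip m y 1 + b * t = t₀) := by
    intro r t ht
    have hx : c + r • (1 : Cliff m) ∈ vectors m := add_mem hc (Submodule.smul_mem _ _ h1)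
    have h2 := Set.ext_iff.1 h (incl (c + r • (1 : Cliff m)) + t • lastGen m)
    rw [Set.mem_ofPred_eq, incl_add_mem_upperHalfSpace hx, re_conj_mul, ip_incl_add hy hx,
      map_add (ip m y), map_smul (ip m y), smul_eq_mul] at h2
    change (_ ∧ _) ↔ _ at h2
    rw [incl_add_mem_upperHalfSpace hx, and_iff_right ht, and_iff_right ht,
      add_sub_right_comm, ← map_sub, add_sub_cancel_left,
      normSq_incl_add (Submodule.smul_mem _ _ h1), normSq_smul, hn, mul_one] at h2
    exact h2
  have k1 := (key 0 R hR).1 (by ring)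
  -- The triple `3, 4, 5` gives two points symmetric in `r`; adding their equations removes the
  -- coefficient of `r`.
  have k2 := (key (3 / 5 * R) (4 / 5 * R) (by positivity)).1 (by ring)
  have k3 := (key (-(3 / 5 * R)) (4 / 5 * R) (by positivity)).1 (by ring)
  have hb : b * R = 0 := by linarith
  have k4 := (key 0 (2 * R) (by positivity)).2 (by linarith)
  nlinarith

end VahlenBisector

end

/-! ### The shape of the bisector according to `s` -/

theorem mainTheorem2 (m : ℕ) (α β γ δ : VahlenBisector.Cliff m)
    (M : Matrix (Fin 2) (Fin 2) (VahlenBisector.Cliff m))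
    (hM : M = !![α, β; γ, δ])
    (hSL : M ∈ VahlenBisector.SLplus m)
    (hSU : M ∉ VahlenBisector.SUplus m)
    (s : ℝ) (hs : s = VahlenBisector.normSq α + VahlenBisector.normSq γ)
    (v : VahlenBisector.Cliff m)
    (hv : v = VahlenBisector.rev β * VahlenBisector.prim α
      + VahlenBisector.rev δ * VahlenBisector.prim γ)
    (P : VahlenBisector.Cliff m) (hP : P = -((s - 1)⁻¹ • v))
    (S : Set (VahlenBisector.Cliff (m + 1)))
    (hS : S = VahlenBisector.bisector (Ring.inverse M) (VahlenBisector.lastGen m)) :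
    v ∈ VahlenBisector.vectors m ∧
    (VahlenBisector.IsHalfSphere S ↔ s ≠ 1) ∧
    (s ≠ 1 → P ∈ VahlenBisector.vectors m ∧
      ∃ R : ℝ, 0 < R ∧ R ^ 2 = (1 + VahlenBisector.normSq P) / s ∧
        S = VahlenBisector.halfSphere P R) ∧
    (VahlenBisector.IsHyperplane S ↔ s = 1) ∧
    (s = 1 → S = {z ∈ VahlenBisector.upperHalfSpace m |
      VahlenBisector.re (VahlenBisector.conj (VahlenBisector.incl v) * z)
        + VahlenBisector.normSq v / 2 = 0}) := by
  open VahlenBisector in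
  subst hM
  have hvV : v ∈ vectors m := hv ▸ SLplus_vector_mem hSL
  have hs0 : 0 < s := hs ▸ SLplus_normSq_pos hSL
  have hmob := mobius_inverse_lastGen hSL
  rw [← hs, ← hv] at hmob
  have hmem : ∀ x ∈ vectors m, ∀ t : ℝ, 0 < t → (incl x + t • lastGen m ∈ S ↔
      s * (s - 1) * (normSq x + t ^ 2) + 2 * s * ip m x v + normSq v + 1 - s = 0) :=
    fun x hx t ht => hS ▸ mem_bisector_iff hs0 hvV hmob hx ht
  have hSub : S ⊆ upperHalfSpace m := hS ▸ fun _ h => h.1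
  have hsphere : s ≠ 1 → P ∈ vectors m ∧
      ∃ R : ℝ, 0 < R ∧ R ^ 2 = (1 + normSq P) / s ∧ S = halfSphere P R := by
    intro h1
    have hs1 : s - 1 ≠ 0 := sub_ne_zero.2 h1
    have hPV : P ∈ vectors m := hP ▸ neg_mem (Submodule.smul_mem _ _ hvV)
    have hpos : 0 < (1 + normSq P) / s :=
      div_pos (add_pos_of_pos_of_nonneg one_pos (normSq_nonneg P)) hs0
    refine ⟨hPV, Real.sqrt ((1 + normSq P) / s), Real.sqrt_pos.2 hpos, Real.sq_sqrt hpos.le,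
      subset_ext hSub (halfSphere_subset _ _) fun x hx t ht => ?_⟩
    rw [hmem x hx t ht, mem_halfSphere hPV hx, and_iff_right ht, Real.sq_sqrt hpos.le, hP,
      normSq_neg, normSq_smul, map_neg, map_smul, smul_eq_mul]
    -- Completing the square; the constant term uses `|P|² = |v|² / (s - 1)²`.
    have e : s * (s - 1) * (normSq x + t ^ 2) + 2 * s * ip m x v + normSq v + 1 - s
        = s * (s - 1) * (normSq x - 2 * -((s - 1)⁻¹ * ip m x v) + (s - 1)⁻¹ ^ 2 * normSq v
          + t ^ 2 - (1 + (s - 1)⁻¹ ^ 2 * normSq v) / s) := by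
      field_simp
      ring
    rw [e, mul_eq_zero, or_iff_right (mul_ne_zero hs0.ne' hs1), sub_eq_zero]
  have hre : ∀ x ∈ vectors m, ∀ t : ℝ,
      re (conj (incl v) * (incl x + t • lastGen m)) = ip m x v := by
    intro x hx t
    have h := ip_incl_add hvV hx 0 t
    rwa [zero_smul, add_zero, zero_mul, add_zero, ← re_conj_mul, ip_comm v x] at h
  have hplane : s = 1 → S = {z ∈ upperHalfSpace m |
      re (conj (incl v) * z) + normSq v / 2 = 0} := by
    rintro h1
    refine subset_ext hSub (fun _ h => h.1) fun x hx t ht => ?_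
    rw [hmem x hx t ht, Set.mem_ofPred_eq, incl_add_mem_upperHalfSpace hx, and_iff_right ht,
      hre x hx, h1]
    constructor <;> intro h <;> linarith
  have hhyp : s = 1 → IsHyperplane S := by
    intro h1
    -- With `v = 0` both points would be `i_n` and the bisector all of the half-space; excluding
    -- `SU₊` rules this out.
    have hv0 : v ≠ 0 := fun h0 => hSU (mem_SUplus hSL (hs ▸ h1) (hv ▸ h0))
    have hnv : normSq v ≠ 0 := fun h => hv0 (normSq_eq_zero.1 h)
    -- The point `-v/2 + i_n` solves `2 ⟨x, v⟩ + |v|² = 0`; the height `1` is arbitrary. The normal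
    -- vector `v` has no `i_n` component.
    refine ⟨⟨incl (-((1 / 2 : ℝ) • v)) + (1 : ℝ) • lastGen m, ?_⟩, incl v + (0 : ℝ) • lastGen m,
      mem_vectors_succ.2 ⟨v, hvV, 0, rfl⟩, fun h => hnv ?_, -(normSq v / 2), ?_⟩
    · rw [hmem _ (neg_mem (Submodule.smul_mem _ _ hvV)) 1 one_pos, map_neg, map_smul, h1,
        LinearMap.neg_apply, LinearMap.smul_apply, ip_self, smul_eq_mul]
      ring
    · have := normSq_incl_add hvV 0
      rw [h, normSq_eq_zero.2 rfl] at this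
      linarith
    · rw [hplane h1, zero_smul, add_zero]
      simp only [← eq_neg_iff_add_eq_zero]
  have hnot : s = 1 → ¬ IsHalfSphere S := by
    rintro h1 ⟨c, hc, R, hR, h⟩
    exact not_isHyperplane_halfSphere hc hR (h ▸ hhyp h1)
  refine ⟨hvV, ⟨fun h h1 => hnot h1 h, fun h1 => ?_⟩, hsphere, ⟨fun h => ?_, hhyp⟩, hplane⟩
  · obtain ⟨hPV, R, hR, -, h⟩ := hsphere h1
    exact ⟨P, hPV, R, hR, h⟩
  · by_contra h1
    obtain ⟨hPV, R, hR, -, h'⟩ := hsphere h1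
    exact not_isHyperplane_halfSphere hPV hR (h' ▸ h)
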